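/- Let $n\ge 2$, let $\Omega\subset\mathbb R^n$ be a bounded domain, let $D$ be an open set with $D\Subset\Omega$, and let $K\Subset D$ be a Borel set ($S\Subset T$ means that $\overline S$ is compact and contained in $T$). Let $A,\alpha,\varepsilon>0$. Then there is a constant $C$, depending only on $n,\Omega,D,K,A,\alpha,\varepsilon$, with the following property. Let $\mu$ be a non-negative Radon measure on $\Omega$ such that $$\mu(B(z,r))\le A\,r^{\,n-2+\alpha}\qquad\text{for all open balls } B(z,r)\subset D .$$ For every bounded subharmonic function $u$ on $\Omega$ (that is, $u\in SH(\Omega)\cap L^\infty(\Omega)$) and every $\delta>0$ such that $K\subset\Omega_\delta:=\{x\in\Omega: d(x,\partial\Omega)>\delta\}$, the function $u_\delta-u$ is $\mu$-integrable on $K$ and $$\int_K (u_\delta-u)\,d\mu\;\le\; C\,\|u\|_{L^\infty(\Omega)}\;\delta^{\frac{\alpha-\varepsilon}{2(1+\alpha)}},\qquad\text{where } u_\delta(x)=\sup_{|y|<\delta}u(x+y).$$ -/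

import Mathlib

open MeasureTheory Metric

/-- A (finite-valued) function `u` is subharmonic on the open set `Ω ⊆ ℝⁿ`: it is upper
semicontinuous on `Ω` and satisfies the sub-mean value inequality on every ball relatively compact
in `Ω`. An upper semicontinuous function is bounded above on such a ball, so its mean there always
makes sense in `[-∞, ∞)`; the inequality `u x ≤ mean` with `u x` finite says that the mean is not
`-∞`, i.e. that `u` is integrable on the ball, and that the inequality holds in `ℝ`.
(A subharmonic function that is essentially bounded never takes the value `-∞`.) -/
structure IsSubharmonicOn {n : ℕ} (u : EuclideanSpace ℝ (Fin n) → ℝ)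
    (Ω : Set (EuclideanSpace ℝ (Fin n))) : Prop where
  upperSemicontinuousOn : UpperSemicontinuousOn u Ω
  integrableOn_ball : ∀ x r, 0 < r → closedBall x r ⊆ Ω → IntegrableOn u (ball x r) volume
  le_average_ball : ∀ x r, 0 < r → closedBall x r ⊆ Ω → u x ≤ ⨍ y in ball x r, u y ∂volume

/-- A Radon measure on the open set `Ω ⊆ ℝⁿ`: a Borel measure that is finite on the compact
subsets of `Ω` (regularity is then automatic). The part of `μ` outside `Ω` plays no role. -/
def IsRadonOn {n : ℕ} (μ : Measure (EuclideanSpace ℝ (Fin n)))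
    (Ω : Set (EuclideanSpace ℝ (Fin n))) : Prop :=
  ∀ L, IsCompact L → L ⊆ Ω → μ L < ⊤

/-- `S ⋐ T`: the closure of `S` is compact and contained in `T`. -/
def CompactlyContained {n : ℕ} (S T : Set (EuclideanSpace ℝ (Fin n))) : Prop :=
  IsCompact (closure S) ∧ closure S ⊆ T

/-- `Ω_δ`, the points of `Ω` at distance greater than `δ` from the boundary of `Ω`. -/
def innerPart {n : ℕ} (Ω : Set (EuclideanSpace ℝ (Fin n))) (δ : ℝ) :
    Set (EuclideanSpace ℝ (Fin n)) :=
  {x | x ∈ Ω ∧ δ < infDist x (frontier Ω)}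

/-- `u_δ(x) = sup {u(x + y) : |y| < δ}`. -/
noncomputable def ballSup {n : ℕ} (u : EuclideanSpace ℝ (Fin n) → ℝ) (δ : ℝ)
    (x : EuclideanSpace ℝ (Fin n)) : ℝ :=
  sSup ((fun y => u (x + y)) '' ball 0 δ)

/-! ### Ball averages and iterated ball averages. -/

section BallAverages

/-! Let `v` be `u` extended by zero outside `Ω`, let `|v| ≤ M`, and let `T_j` be its iterated mean
over radii `s, s/2, …, s/2^j`. The sub-mean inequality gives `u ≤ T_j` near `K`. The first mean is
Lipschitz with constant `2nM/s` and further means preserve this, so `u_δ ≤ T_j + 2nMδ/s` on `K`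
(`ballSup_le_iterAvg`).

It remains to compare `T_j` with `u` in `μ`-mean, although `μ` may be singular. Adding the radius
`s` in front of `s/2, s/4, …` changes the iterated mean by an iterated mean of `h = ballAvg s v -
v`, and `h ≥ 0` near `K`. An iterated mean of `h` starting at radius `s/2` is at most `|B(s/2)|⁻¹`
times the integral of `h` over a ball of radius `s`. By Fubini its `μ`-integral over `K` is then at
most a constant times `s^(-n) · A s^(n-2+α) · ∫ h`. Moving the averaging onto a `C²` cutoff shows
that the Lebesgue integral of `h` near `K` is `O(M s²)` (`integral_ballAvg_sub_mul_le`). Each step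
thus costs `O(M s^α)` (`exists_step_bound`), and the costs at `s, s/2, s/4, …` form a geometric
series.

Letting `j → ∞` gives `∫_K (u_δ - u) dμ ≤ C M (s^α + δ/s)`. The choice `s = δ^(1/(1+α))` yields the
exponent `α/(1+α)`, which is stronger than the required one for small `δ`. For the remaining `δ`,
bounded above because `Ω` is bounded, the trivial bound `2M μ(K)` suffices. -/

/-- Bounded Borel functions on `ℝⁿ`. -/
structure IsBddMeasurable {n : ℕ} (f : EuclideanSpace ℝ (Fin n) → ℝ) : Prop where
  measurable : Measurable f
  bounded : ∃ M, ∀ x, |f x| ≤ M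

/-- The uniform probability measure on the ball of radius `s` centred at the origin. -/
noncomputable def uniformBall (n : ℕ) (s : ℝ) : Measure (EuclideanSpace ℝ (Fin n)) :=
  (volume (ball (0 : EuclideanSpace ℝ (Fin n)) s))⁻¹ • volume.restrict (ball 0 s)

/-- The mean of `f` over the ball of centre `x` and radius `s`. -/
noncomputable def ballAvg {n : ℕ} (s : ℝ) (f : EuclideanSpace ℝ (Fin n) → ℝ)
    (x : EuclideanSpace ℝ (Fin n)) : ℝ :=
  ∫ y, f (x + y) ∂(uniformBall n s)

/-- The iterated mean of `f` over balls of radii `s, s / 2, …, s / 2 ^ j`, where the mean of radius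
`s` is taken first. -/
noncomputable def iterAvg {n : ℕ} :
    ℕ → ℝ → (EuclideanSpace ℝ (Fin n) → ℝ) → EuclideanSpace ℝ (Fin n) → ℝ
  | 0, s, f => ballAvg s f
  | j + 1, s, f => iterAvg j (s / 2) (ballAvg s f)

variable {n : ℕ} {f g : EuclideanSpace ℝ (Fin n) → ℝ} {s : ℝ}

theorem IsBddMeasurable.const (c : ℝ) :
    IsBddMeasurable (fun _ : EuclideanSpace ℝ (Fin n) => c) :=
  ⟨measurable_const, |c|, fun _ => le_rfl⟩

theorem IsBddMeasurable.sub (hf : IsBddMeasurable f) (hg : IsBddMeasurable g) :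
    IsBddMeasurable (fun x => f x - g x) := by
  obtain ⟨M, hM⟩ := hf.bounded
  obtain ⟨N, hN⟩ := hg.bounded
  exact ⟨hf.measurable.sub hg.measurable, M + N,
    fun x => (abs_sub _ _).trans (add_le_add (hM x) (hN x))⟩

theorem IsBddMeasurable.integrable (hf : IsBddMeasurable f)
    (μ : Measure (EuclideanSpace ℝ (Fin n))) [IsFiniteMeasure μ] : Integrable f μ := by
  obtain ⟨M, hM⟩ := hf.bounded
  exact Integrable.of_bound hf.measurable.aestronglyMeasurable M (ae_of_all _ hM)

theorem IsBddMeasurable.integrableOn (hf : IsBddMeasurable f)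
    {S : Set (EuclideanSpace ℝ (Fin n))} (hS : volume S < ⊤) : IntegrableOn f S := by
  have : IsFiniteMeasure (volume.restrict S) := ⟨by simpa using hS⟩
  exact hf.integrable _

theorem IsBddMeasurable.translate (hf : IsBddMeasurable f) (x : EuclideanSpace ℝ (Fin n)) :
    IsBddMeasurable (fun y => f (x + y)) :=
  ⟨hf.measurable.comp (measurable_const_add x), hf.bounded.imp fun _ h y => h (x + y)⟩

theorem volume_real_ball_pos (x : EuclideanSpace ℝ (Fin n)) (hs : 0 < s) :
    0 < volume.real (ball x s) :=
  ENNReal.toReal_pos (measure_ball_pos _ _ hs).ne' measure_ball_lt_top.ne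

theorem volume_real_ball (x : EuclideanSpace ℝ (Fin n)) (hs : 0 < s) :
    volume.real (ball x s) =
      s ^ n * volume.real (ball (0 : EuclideanSpace ℝ (Fin n)) 1) := by
  rw [measureReal_def, Measure.addHaar_ball_of_pos _ _ hs, ENNReal.toReal_mul,
    ENNReal.toReal_ofReal (by positivity), finrank_euclideanSpace_fin, measureReal_def]

theorem isProbabilityMeasure_uniformBall (hs : 0 < s) :
    IsProbabilityMeasure (uniformBall n s) := by
  refine ⟨?_⟩
  simp only [uniformBall, Measure.smul_apply, Measure.restrict_apply_univ, smul_eq_mul]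
  exact ENNReal.inv_mul_cancel (measure_ball_pos _ _ hs).ne' measure_ball_lt_top.ne

theorem ae_uniformBall_mem : ∀ᵐ y ∂(uniformBall n s), y ∈ ball 0 s :=
  Measure.ae_smul_measure (ae_restrict_mem measurableSet_ball) _

theorem ballAvg_eq_integral (f : EuclideanSpace ℝ (Fin n) → ℝ) (s : ℝ)
    (x : EuclideanSpace ℝ (Fin n)) :
    ballAvg s f x =
      (volume.real (ball (0 : EuclideanSpace ℝ (Fin n)) s))⁻¹ * ∫ y in ball x s, f y := by
  have h : ∫ y in ball 0 s, f (x + y) = ∫ y in ball x s, f y := by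
    have := (measurePreserving_add_left volume x).setIntegral_preimage_emb
      (MeasurableEquiv.addLeft x).measurableEmbedding f (ball x s)
    rw [← this]
    simp [preimage_add_ball]
  rw [ballAvg, uniformBall, integral_smul_measure, h, ENNReal.toReal_inv, smul_eq_mul,
    measureReal_def]

theorem ballAvg_eq_average (f : EuclideanSpace ℝ (Fin n) → ℝ) (s : ℝ)
    (x : EuclideanSpace ℝ (Fin n)) : ballAvg s f x = ⨍ y in ball x s, f y := by
  rw [ballAvg_eq_integral, setAverage_eq, smul_eq_mul,
    Measure.addHaar_real_ball_center volume x]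

theorem IsBddMeasurable.ballAvg (hf : IsBddMeasurable f) (hs : 0 < s) :
    IsBddMeasurable (ballAvg s f) := by
  have := isProbabilityMeasure_uniformBall (n := n) hs
  refine ⟨?_, ?_⟩
  · have : StronglyMeasurable (fun p : EuclideanSpace ℝ (Fin n) × EuclideanSpace ℝ (Fin n) =>
        f (p.1 + p.2)) := (hf.measurable.comp (measurable_fst.add measurable_snd)).stronglyMeasurable
    exact this.integral_prod_right.measurable
  · obtain ⟨M, hM⟩ := hf.bounded
    refine ⟨M, fun x => ?_⟩
    have := norm_integral_le_of_norm_le_const (μ := uniformBall n s) (f := fun y => f (x + y))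
      (C := M) (ae_of_all _ fun y => hM (x + y))
    simpa [_root_.ballAvg] using this

theorem ballAvg_mono_on (hf : IsBddMeasurable f) (hg : IsBddMeasurable g) (hs : 0 < s)
    {x : EuclideanSpace ℝ (Fin n)} (h : ∀ y ∈ ball x s, f y ≤ g y) :
    ballAvg s f x ≤ ballAvg s g x := by
  have := isProbabilityMeasure_uniformBall (n := n) hs
  refine integral_mono_ae ((hf.translate x).integrable _) ((hg.translate x).integrable _) ?_
  filter_upwards [ae_uniformBall_mem (n := n) (s := s)] with y hy
  exact h _ (by simpa using hy)

theorem ballAvg_sub (hf : IsBddMeasurable f) (hg : IsBddMeasurable g) (hs : 0 < s) :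
    ballAvg s (fun x => f x - g x) = fun x => ballAvg s f x - ballAvg s g x := by
  have := isProbabilityMeasure_uniformBall (n := n) hs
  funext x
  exact integral_sub ((hf.translate x).integrable _) ((hg.translate x).integrable _)

theorem ballAvg_const (c : ℝ) (hs : 0 < s) (x : EuclideanSpace ℝ (Fin n)) :
    ballAvg s (fun _ => c) x = c := by
  have := isProbabilityMeasure_uniformBall (n := n) hs
  simp [ballAvg]

theorem abs_ballAvg_le (hf : IsBddMeasurable f) (hs : 0 < s) {M : ℝ} (hM : ∀ x, |f x| ≤ M)
    (x : EuclideanSpace ℝ (Fin n)) : |ballAvg s f x| ≤ M := by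
  rw [abs_le]
  constructor
  · rw [← ballAvg_const (n := n) (-M) hs x]
    exact ballAvg_mono_on (.const _) hf hs fun y _ => (abs_le.1 (hM y)).1
  · rw [← ballAvg_const (n := n) M hs x]
    exact ballAvg_mono_on hf (.const _) hs fun y _ => (abs_le.1 (hM y)).2

theorem IsBddMeasurable.iterAvg (j : ℕ) (hf : IsBddMeasurable f) (hs : 0 < s) :
    IsBddMeasurable (iterAvg j s f) := by
  induction j generalizing s f with
  | zero => exact hf.ballAvg hs
  | succ j ih => exact ih (hf.ballAvg hs) (half_pos hs)

/-- The radii sum to less than `2 * s`, so values outside that ball never enter. -/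
theorem iterAvg_mono_on (j : ℕ) (hf : IsBddMeasurable f) (hg : IsBddMeasurable g) (hs : 0 < s)
    {x : EuclideanSpace ℝ (Fin n)} (h : ∀ y ∈ ball x (2 * s), f y ≤ g y) :
    iterAvg j s f x ≤ iterAvg j s g x := by
  induction j generalizing s f g with
  | zero => exact ballAvg_mono_on hf hg hs fun y hy => h y (ball_subset_ball (by linarith) hy)
  | succ j ih =>
    refine ih (hf.ballAvg hs) (hg.ballAvg hs) (half_pos hs) fun y hy => ?_
    refine ballAvg_mono_on hf hg hs fun z hz => h z ?_
    rw [mem_ball] at *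
    linarith [dist_triangle z y x]

theorem iterAvg_sub (j : ℕ) (hf : IsBddMeasurable f) (hg : IsBddMeasurable g) (hs : 0 < s) :
    iterAvg j s (fun x => f x - g x) = fun x => iterAvg j s f x - iterAvg j s g x := by
  induction j generalizing s f g with
  | zero => exact ballAvg_sub hf hg hs
  | succ j ih =>
    simp only [iterAvg]
    rw [ballAvg_sub hf hg hs, ih (hf.ballAvg hs) (hg.ballAvg hs) (half_pos hs)]

theorem iterAvg_const (j : ℕ) (c : ℝ) (hs : 0 < s) (x : EuclideanSpace ℝ (Fin n)) :
    iterAvg j s (fun _ => c) x = c := by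
  induction j generalizing s with
  | zero => exact ballAvg_const c hs x
  | succ j ih =>
    have : ballAvg s (fun _ : EuclideanSpace ℝ (Fin n) => c) = fun _ => c :=
      funext (ballAvg_const c hs)
    rw [iterAvg, this, ih (half_pos hs)]

/-- The sub-mean inequality is used for `f` only; monotonicity carries it through the later means,
which need not be shown subharmonic. -/
theorem le_iterAvg (j : ℕ) (hf : IsBddMeasurable f) (hs : 0 < s) {x : EuclideanSpace ℝ (Fin n)}
    (h : ∀ y ∈ ball x (2 * s), ∀ t, 0 < t → t ≤ s → dist y x + t ≤ 2 * s → f y ≤ ballAvg t f y) :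
    f x ≤ iterAvg j s f x := by
  induction j generalizing s with
  | zero => exact h x (mem_ball_self (by linarith)) s hs le_rfl (by rw [dist_self]; linarith)
  | succ j ih =>
    have h1 : f x ≤ iterAvg j (s / 2) f x := by
      refine ih (half_pos hs) fun y hy t ht hts hyt =>
        h y (ball_subset_ball (by linarith) hy) t ht (by linarith) (by linarith)
    refine h1.trans (iterAvg_mono_on j hf (hf.ballAvg hs) (half_pos hs) fun y hy => ?_)
    refine h y (ball_subset_ball (by linarith) hy) s hs le_rfl ?_
    rw [mem_ball] at hy
    linarith

theorem iterAvg_succ_sub (j : ℕ) (hf : IsBddMeasurable f) (hs : 0 < s)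
    (x : EuclideanSpace ℝ (Fin n)) :
    iterAvg (j + 1) s f x - iterAvg j (s / 2) f x =
      iterAvg j (s / 2) (fun y => ballAvg s f y - f y) x := by
  rw [iterAvg_sub j (hf.ballAvg hs) hf (half_pos hs), iterAvg]

theorem ballAvg_sub_le_of_lipschitz (hf : IsBddMeasurable f) (hs : 0 < s) {L : ℝ}
    (hL : ∀ x y, f x - f y ≤ L * dist x y) (x y : EuclideanSpace ℝ (Fin n)) :
    ballAvg s f x - ballAvg s f y ≤ L * dist x y := by
  have := isProbabilityMeasure_uniformBall (n := n) hs
  rw [ballAvg, ballAvg,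
    ← integral_sub ((hf.translate x).integrable _) ((hf.translate y).integrable _)]
  calc _ ≤ ∫ _, L * dist x y ∂(uniformBall n s) := by
        refine integral_mono (((hf.translate x).integrable _).sub ((hf.translate y).integrable _))
          (integrable_const _) fun z => ?_
        simpa using hL (x + z) (y + z)
    _ = L * dist x y := by simp

theorem iterAvg_sub_le_of_lipschitz (j : ℕ) (hf : IsBddMeasurable f) (hs : 0 < s) {L : ℝ}
    (hL : ∀ x y, f x - f y ≤ L * dist x y) (x y : EuclideanSpace ℝ (Fin n)) :
    iterAvg j s f x - iterAvg j s f y ≤ L * dist x y := by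
  induction j generalizing s f with
  | zero => exact ballAvg_sub_le_of_lipschitz hf hs hL x y
  | succ j ih => exact ih (hf.ballAvg hs) (half_pos hs) (ballAvg_sub_le_of_lipschitz hf hs hL)

/-- With `t = dist x y < s`, the difference lies in the shell between radii `s - t` and `s` about
`x`, and Bernoulli's inequality bounds `1 - (1 - t/s)^n` by `n t / s`. -/
theorem volume_real_ball_diff_le (hs : 0 < s) (x y : EuclideanSpace ℝ (Fin n)) :
    volume.real (ball x s \ ball y s) ≤
      n * (dist x y / s) * volume.real (ball (0 : EuclideanSpace ℝ (Fin n)) s) := by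
  have hV := volume_real_ball_pos (0 : EuclideanSpace ℝ (Fin n)) hs
  have hd : volume.real (ball x s \ ball y s) ≤
      volume.real (ball (0 : EuclideanSpace ℝ (Fin n)) s) := by
    rw [← Measure.addHaar_real_ball_center volume x]
    exact measureReal_mono Set.sdiff_subset measure_ball_lt_top.ne
  rcases Nat.eq_zero_or_pos n with rfl | hn
  · have : x = y := Subsingleton.elim _ _
    simp [this]
  have hn1 : (1 : ℝ) ≤ n := by exact_mod_cast hn
  rcases le_or_gt s (dist x y) with h | h
  · have : 1 ≤ n * (dist x y / s) := by
      have : 1 ≤ dist x y / s := (one_le_div hs).2 h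
      nlinarith
    nlinarith
  · set t := dist x y with ht
    have hsub : ball x (s - t) ⊆ ball y s := ball_subset_ball' (by linarith)
    have hsub' : ball x (s - t) ⊆ ball x s :=
      ball_subset_ball (by linarith [dist_nonneg (x := x) (y := y)])
    have h1 : volume.real (ball x s \ ball y s) ≤ volume.real (ball x s \ ball x (s - t)) :=
      measureReal_mono (Set.sdiff_subset_sdiff_right hsub)
        ((measure_mono Set.sdiff_subset).trans_lt measure_ball_lt_top).ne
    rw [measureReal_sdiff hsub' measurableSet_ball measure_ball_lt_top.ne,
      volume_real_ball x hs, volume_real_ball x (by linarith : 0 < s - t)] at h1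
    rw [volume_real_ball _ hs]
    have hB := one_add_mul_sub_le_pow (a := (s - t) / s)
      (by have : 0 ≤ (s - t) / s := div_nonneg (by linarith) hs.le
          linarith) n
    have e1 : (s - t) / s - 1 = -(t / s) := by field_simp; ring
    rw [e1, div_pow, le_div_iff₀ (by positivity)] at hB
    have hV1 := volume_real_ball_pos (0 : EuclideanSpace ℝ (Fin n)) one_pos
    nlinarith

theorem ballAvg_sub_le_of_bounded (hf : IsBddMeasurable f) (hs : 0 < s) {M : ℝ}
    (hM : ∀ x, |f x| ≤ M) (x y : EuclideanSpace ℝ (Fin n)) :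
    ballAvg s f x - ballAvg s f y ≤ 2 * n * M / s * dist x y := by
  have hV := volume_real_ball_pos (0 : EuclideanSpace ℝ (Fin n)) hs
  have hM0 : 0 ≤ M := (abs_nonneg _).trans (hM 0)
  have key : ∀ a b, |∫ z in ball a s \ ball b s, f z| ≤
      M * (n * (dist a b / s) * volume.real (ball (0 : EuclideanSpace ℝ (Fin n)) s)) := by
    intro a b
    refine (norm_setIntegral_le_of_norm_le_const (f := f) (C := M)
      ((measure_mono Set.sdiff_subset).trans_lt measure_ball_lt_top) fun z _ => hM z).trans ?_
    exact mul_le_mul_of_nonneg_left (volume_real_ball_diff_le hs a b) hM0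
  have h1 := integral_inter_add_sdiff (μ := volume) (f := f) (s := ball x s) (t := ball y s)
    measurableSet_ball (hf.integrableOn measure_ball_lt_top)
  have h2 := integral_inter_add_sdiff (μ := volume) (f := f) (s := ball y s) (t := ball x s)
    measurableSet_ball (hf.integrableOn measure_ball_lt_top)
  rw [Set.inter_comm] at h2
  rw [ballAvg_eq_integral, ballAvg_eq_integral, ← mul_sub, inv_mul_le_iff₀ hV]
  have k1 := (abs_le.1 (key x y)).2
  have k2 := (abs_le.1 (key y x)).1
  rw [dist_comm y x] at k2
  have e : volume.real (ball (0 : EuclideanSpace ℝ (Fin n)) s) * (2 * n * M / s * dist x y) =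
    2 * (M * (n * (dist x y / s) * volume.real (ball (0 : EuclideanSpace ℝ (Fin n)) s))) := by ring
  rw [e]
  linarith

/-- The constant does not depend on `j`: the largest radius is averaged first, and later means
preserve Lipschitz bounds. -/
theorem iterAvg_sub_le_of_bounded (j : ℕ) (hf : IsBddMeasurable f) (hs : 0 < s) {M : ℝ}
    (hM : ∀ x, |f x| ≤ M) (x y : EuclideanSpace ℝ (Fin n)) :
    iterAvg j s f x - iterAvg j s f y ≤ 2 * n * M / s * dist x y := by
  cases j with
  | zero => exact ballAvg_sub_le_of_bounded hf hs hM x y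
  | succ j =>
    exact iterAvg_sub_le_of_lipschitz j (hf.ballAvg hs) (half_pos hs)
      (ballAvg_sub_le_of_bounded hf hs hM) x y

/-- Only the first mean pays the factor `|B(s)|⁻¹`; the later ones average its values at points
within `s` of `x`, so the bound is uniform in `j`. -/
theorem iterAvg_le_integral (j : ℕ) (hf : IsBddMeasurable f) (hs : 0 < s)
    {x : EuclideanSpace ℝ (Fin n)} (h : ∀ y ∈ ball x (2 * s), 0 ≤ f y) :
    iterAvg j s f x ≤ (volume.real (ball (0 : EuclideanSpace ℝ (Fin n)) s))⁻¹ *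
      ∫ y in ball x (2 * s), f y := by
  have key : ∀ y ∈ ball x s, ballAvg s f y ≤
      (volume.real (ball (0 : EuclideanSpace ℝ (Fin n)) s))⁻¹ * ∫ y in ball x (2 * s), f y := by
    intro y hy
    rw [ballAvg_eq_integral]
    refine mul_le_mul_of_nonneg_left ?_ (by positivity)
    refine setIntegral_mono_set ?_ ?_ (Filter.Eventually.of_forall ?_)
    · exact hf.integrableOn measure_ball_lt_top
    · filter_upwards [ae_restrict_mem measurableSet_ball] with z hz using h z hz
    · refine fun z hz => ball_subset_ball' (?_ : s + dist y x ≤ 2 * s) hz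
      rw [mem_ball] at hy
      linarith
  cases j with
  | zero => exact key x (mem_ball_self hs)
  | succ j =>
    have := iterAvg_mono_on j (hf.ballAvg hs) (.const ((volume.real
      (ball (0 : EuclideanSpace ℝ (Fin n)) s))⁻¹ * ∫ y in ball x (2 * s), f y)) (half_pos hs)
      (x := x) fun y hy => key y (by rwa [mul_div_cancel₀ s (two_ne_zero)] at hy)
    rwa [iterAvg_const _ _ (half_pos hs)] at this

end BallAverages

/-! ### Second differences of a cutoff, and integration of iterated means against a measure. -/

section SmoothCutoff

variable {n : ℕ} {s : ℝ}

/-- Second differences of a compactly supported `C²` function are quadratically small. -/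
theorem exists_abs_secondDiff_le {χ : EuclideanSpace ℝ (Fin n) → ℝ} (hχ : ContDiff ℝ 2 χ)
    (hc : HasCompactSupport χ) :
    ∃ L : ℝ, 0 ≤ L ∧ ∀ x y, |χ (x - y) + χ (x + y) - 2 * χ x| ≤ L * ‖y‖ ^ 2 := by
  obtain ⟨L, hL⟩ := ContDiff.lipschitzWith_of_hasCompactSupport (𝕂 := ℝ) (hc.fderiv ℝ)
    (hχ.fderiv_right (m := 1) (by norm_num)) one_ne_zero
  -- Mean value inequality for `z ↦ χ (x - z) + χ (x + z)`, whose derivative at `z` has norm at most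
  -- `2 * L * ‖z‖`, where `L` is a Lipschitz constant of `fderiv ℝ χ`.
  refine ⟨2 * L, by positivity, fun x y => ?_⟩
  have hd : ∀ z ∈ closedBall (0 : EuclideanSpace ℝ (Fin n)) ‖y‖,
      HasFDerivWithinAt (fun z => χ (x - z) + χ (x + z))
        (-(fderiv ℝ χ (x - z)) + fderiv ℝ χ (x + z)) (closedBall 0 ‖y‖) z := by
    intro z _
    have hdiff := hχ.differentiable two_ne_zero
    have h1 : HasFDerivAt (fun z => χ (x - z)) (-(fderiv ℝ χ (x - z))) z := by
      simpa [Function.comp_def] using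
        (hdiff (x - z)).hasFDerivAt.comp z ((hasFDerivAt_id z).const_sub x)
    have h2 : HasFDerivAt (fun z => χ (x + z)) (fderiv ℝ χ (x + z)) z := by
      simpa [Function.comp_def] using
        (hdiff (x + z)).hasFDerivAt.comp z ((hasFDerivAt_id z).const_add x)
    exact (h1.add h2).hasFDerivWithinAt
  have hbd : ∀ z ∈ closedBall (0 : EuclideanSpace ℝ (Fin n)) ‖y‖,
      ‖-(fderiv ℝ χ (x - z)) + fderiv ℝ χ (x + z)‖ ≤ 2 * L * ‖y‖ := by
    intro z hz
    rw [mem_closedBall_zero_iff] at hz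
    rw [neg_add_eq_sub]
    refine (hL.norm_sub_le (x + z) (x - z)).trans ?_
    have : ‖x + z - (x - z)‖ ≤ 2 * ‖y‖ := by
      have e : x + z - (x - z) = z + z := by abel
      rw [e]
      exact (norm_add_le z z).trans (by linarith)
    calc (L : ℝ) * ‖x + z - (x - z)‖ ≤ L * (2 * ‖y‖) := by gcongr
      _ = 2 * L * ‖y‖ := by ring
  have := (convex_closedBall _ _).norm_image_sub_le_of_norm_hasFDerivWithin_le hd hbd
    (mem_closedBall_self (norm_nonneg y)) (mem_closedBall_zero_iff.2 le_rfl)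
  simp only [sub_zero, add_zero, Real.norm_eq_abs] at this
  calc |χ (x - y) + χ (x + y) - 2 * χ x| = |χ (x - y) + χ (x + y) - (χ x + χ x)| := by ring_nf
    _ ≤ 2 * L * ‖y‖ * ‖y‖ := this
    _ = 2 * L * ‖y‖ ^ 2 := by ring

theorem integral_uniformBall_neg (J : EuclideanSpace ℝ (Fin n) → ℝ) (s : ℝ) :
    ∫ y, J (-y) ∂(uniformBall n s) = ∫ y, J y ∂(uniformBall n s) := by
  have := (Measure.measurePreserving_neg (volume : Measure (EuclideanSpace ℝ (Fin n)))).setIntegral_preimage_emb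
    (MeasurableEquiv.neg _).measurableEmbedding J (ball 0 s)
  rw [uniformBall, integral_smul_measure, integral_smul_measure, ← this]
  simp

/-- The integral form of `∫ (Δv) χ = ∫ v (Δχ)`, at scale `s`. -/
theorem integral_ballAvg_sub_mul_le {v χ : EuclideanSpace ℝ (Fin n) → ℝ} (hv : IsBddMeasurable v)
    (hs : 0 < s) {M : ℝ} (hM : ∀ x, |v x| ≤ M) {Ω : Set (EuclideanSpace ℝ (Fin n))}
    (hΩ : volume Ω < ⊤) (hΩm : MeasurableSet Ω) (hvΩ : ∀ x ∉ Ω, v x = 0) (hχ : Continuous χ)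
    (hc : HasCompactSupport χ) {L : ℝ} (hL0 : 0 ≤ L)
    (hL : ∀ x y, |χ (x - y) + χ (x + y) - 2 * χ x| ≤ L * ‖y‖ ^ 2) :
    ∫ x, (ballAvg s v x - v x) * χ x ≤ L * volume.real Ω * M * s ^ 2 := by
  have hP := isProbabilityMeasure_uniformBall (n := n) hs
  have hM0 : 0 ≤ M := (abs_nonneg _).trans (hM 0)
  obtain ⟨N, hN⟩ := hc.exists_bound_of_continuous hχ
  have hχi : Integrable χ := hχ.integrable_of_hasCompactSupport hc
  have hvi : Integrable v := by
    have : v = Ω.indicator v := by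
      funext x
      by_cases hx : x ∈ Ω
      · simp [hx]
      · simp [hx, hvΩ x hx]
    rw [this]
    exact (hv.integrableOn hΩ).integrable_indicator hΩm
  -- Fubini makes the integral the mean of `J`. Translation moves `y` onto `χ`, and by the symmetry
  -- of the ball `J y` may be paired with `J (-y)`, which leaves a second difference of `χ`.
  set J : EuclideanSpace ℝ (Fin n) → ℝ := fun y => ∫ x, (v (x + y) - v x) * χ x with hJ
  have hprod : Integrable (fun p : EuclideanSpace ℝ (Fin n) × EuclideanSpace ℝ (Fin n) =>
      (v (p.1 + p.2) - v p.1) * χ p.1) (volume.prod (uniformBall n s)) := by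
    refine (hχi.comp_fst (uniformBall n s)).bdd_mul (c := M + M) ?_ (ae_of_all _ fun p => ?_)
    · exact ((hv.measurable.comp (measurable_fst.add measurable_snd)).sub
        (hv.measurable.comp measurable_fst)).aestronglyMeasurable
    · exact (abs_sub _ _).trans (add_le_add (hM _) (hM _))
  have h1 : ∫ x, (ballAvg s v x - v x) * χ x = ∫ y, J y ∂(uniformBall n s) := by
    rw [hJ, ← integral_integral_swap hprod]
    refine integral_congr_ae (ae_of_all _ fun x => ?_)
    simp only
    rw [integral_mul_const, integral_sub ((hv.translate x).integrable _) (integrable_const _)]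
    simp [ballAvg]
  have hJi : Integrable J (uniformBall n s) := hprod.integral_prod_right
  have hJni : Integrable (fun y => J (-y)) (uniformBall n s) := by
    have hsm : Measurable J := by
      have : StronglyMeasurable (fun p : EuclideanSpace ℝ (Fin n) × EuclideanSpace ℝ (Fin n) =>
          (v (p.2 + p.1) - v p.2) * χ p.2) :=
        (((hv.measurable.comp (measurable_snd.add measurable_fst)).sub
          (hv.measurable.comp measurable_snd)).mul
            (hχ.measurable.comp measurable_snd)).stronglyMeasurable
      exact this.integral_prod_right.measurable
    refine Integrable.of_bound (hsm.comp measurable_neg).aestronglyMeasurable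
      ((M + M) * ∫ x, ‖χ x‖) (ae_of_all _ fun y => ?_)
    rw [← integral_const_mul]
    refine norm_integral_le_of_norm_le (hχi.norm.const_mul _) (ae_of_all _ fun x => ?_)
    rw [norm_mul]
    gcongr
    exact (abs_sub _ _).trans (add_le_add (hM _) (hM _))
  have hshift : ∀ y, Integrable (fun x => v x * χ (x - y)) := fun y =>
    hvi.mul_bdd (c := N) (hχ.comp (continuous_id.sub continuous_const)).aestronglyMeasurable
      (ae_of_all _ fun x => hN _)
  have hvχ : Integrable (fun x => v x * χ x) := by simpa using hshift 0
  have hJeq : ∀ y, J y = (∫ x, v x * χ (x - y)) - ∫ x, v x * χ x := by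
    intro y
    have e : ∫ x, v (x + y) * χ x = ∫ x, v x * χ (x - y) := by
      rw [← integral_add_right_eq_self (fun x => v x * χ (x - y)) y]
      simp
    have hi : Integrable (fun x => v (x + y) * χ x) := by
      have := (hshift y).comp_add_right y
      simpa using this
    rw [hJ]
    simp only [sub_mul]
    rw [integral_sub hi hvχ, e]
  have hJJ : ∀ y, y ∈ ball (0 : EuclideanSpace ℝ (Fin n)) s →
      J y + J (-y) ≤ L * volume.real Ω * M * s ^ 2 := by
    intro y hy
    have e : J y + J (-y) = ∫ x in Ω, v x * (χ (x - y) + χ (x + y) - 2 * χ x) := by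
      rw [setIntegral_eq_integral_of_forall_compl_eq_zero (fun x hx => by simp [hvΩ x hx]),
        hJeq, hJeq]
      have h2 := hshift (-y)
      simp only [sub_neg_eq_add] at h2 ⊢
      have : ∀ x, v x * (χ (x - y) + χ (x + y) - 2 * χ x) =
          (v x * χ (x - y) - v x * χ x) + (v x * χ (x + y) - v x * χ x) := fun x => by ring
      simp only [this]
      rw [integral_add (f := fun x => v x * χ (x - y) - v x * χ x)
        (g := fun x => v x * χ (x + y) - v x * χ x) ((hshift y).sub hvχ) (h2.sub hvχ), integral_sub (hshift y) hvχ,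
        integral_sub h2 hvχ]
    rw [e]
    refine (le_abs_self _).trans ?_
    have := norm_setIntegral_le_of_norm_le_const (μ := volume) (s := Ω)
      (f := fun x => v x * (χ (x - y) + χ (x + y) - 2 * χ x)) (C := M * (L * s ^ 2)) hΩ
      fun x _ => by
        rw [norm_mul]
        refine mul_le_mul (hM x) ((hL x y).trans ?_) (norm_nonneg _) hM0
        rw [mem_ball_zero_iff] at hy
        gcongr
    refine this.trans (le_of_eq ?_)
    ring
  have h2 : 2 * ∫ y, J y ∂(uniformBall n s) = ∫ y, (J y + J (-y)) ∂(uniformBall n s) := by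
    rw [integral_add hJi hJni, integral_uniformBall_neg]
    ring
  have h3 : ∫ y, (J y + J (-y)) ∂(uniformBall n s) ≤ L * volume.real Ω * M * s ^ 2 := by
    calc _ ≤ ∫ _, L * volume.real Ω * M * s ^ 2 ∂(uniformBall n s) := by
          refine integral_mono_ae (hJi.add hJni) (integrable_const _) ?_
          filter_upwards [ae_uniformBall_mem (n := n) (s := s)] with y hy using hJJ y hy
      _ = _ := by simp
  have h4 : 0 ≤ L * volume.real Ω * M * s ^ 2 := by positivity
  rw [h1]
  linarith

theorem exists_cutoff {K : Set (EuclideanSpace ℝ (Fin n))} (hK : Bornology.IsBounded K) {ρ : ℝ}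
    (hρ : 0 < ρ) :
    ∃ χ : EuclideanSpace ℝ (Fin n) → ℝ, ContDiff ℝ 2 χ ∧ HasCompactSupport χ ∧
      (∀ x, 0 ≤ χ x) ∧ (∀ x ∈ thickening ρ K, χ x = 1) ∧ ∀ x ∉ thickening (2 * ρ) K, χ x = 0 := by
  obtain ⟨f, h1, h0, hf⟩ := exists_contMDiffMap_one_nhds_of_subset_interior
    (modelWithCornersSelf ℝ (EuclideanSpace ℝ (Fin n))) (n := 2) (s := cthickening ρ K)
    (t := thickening (2 * ρ) K) isClosed_cthickening
    (by rw [isOpen_thickening.interior_eq]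
        exact cthickening_subset_thickening' (by linarith) (by linarith) K)
  refine ⟨f, f.contMDiff.contDiff, ?_, fun x => (hf x).1,
    fun x hx => h1.self_of_nhdsSet x (thickening_subset_cthickening _ _ hx), h0⟩
  refine HasCompactSupport.of_support_subset_isCompact
    (K := closure (thickening (2 * ρ) K)) (hK.thickening).isCompact_closure fun x hx => ?_
  by_contra h
  exact hx (h0 x fun h' => h (subset_closure h'))

/-- Integrating iterated means of a nonnegative function against a measure whose balls of radius
`2 * s` have mass at most `B`. -/
theorem integral_iterAvg_le (j : ℕ) {f : EuclideanSpace ℝ (Fin n) → ℝ} (hf : IsBddMeasurable f)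
    (hs : 0 < s) (ν : Measure (EuclideanSpace ℝ (Fin n))) [IsFiniteMeasure ν]
    {U : Set (EuclideanSpace ℝ (Fin n))} (hU : MeasurableSet U) (hUv : volume U < ⊤)
    (hνU : ∀ᵐ x ∂ν, ball x (2 * s) ⊆ U) (hfU : ∀ z ∈ U, 0 ≤ f z) {B : ℝ}
    (hB : ∀ z ∈ U, ν.real (ball z (2 * s)) ≤ B) :
    ∫ x, iterAvg j s f x ∂ν ≤ (volume.real (ball (0 : EuclideanSpace ℝ (Fin n)) s))⁻¹ *
      (B * ∫ z in U, f z) := by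
  have hUf : IsFiniteMeasure (volume.restrict U) := ⟨by simpa using hUv⟩
  set F : EuclideanSpace ℝ (Fin n) → EuclideanSpace ℝ (Fin n) → ℝ :=
    fun x z => (ball x (2 * s)).indicator f z with hF
  have hFeq : ∀ x z, F x z = (ball z (2 * s)).indicator (fun _ => f z) x := by
    intro x z
    by_cases h : z ∈ ball x (2 * s)
    · rw [hF, Set.indicator_of_mem (mem_ball_comm.1 h)]
      exact Set.indicator_of_mem h _
    · rw [hF, Set.indicator_of_notMem fun h' => h (mem_ball_comm.1 h')]
      exact Set.indicator_of_notMem h _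
  have hFint : Integrable (Function.uncurry F) (ν.prod (volume.restrict U)) := by
    obtain ⟨M, hM⟩ := hf.bounded
    have hm : Measurable (Function.uncurry F) := by
      have : Function.uncurry F = {p : EuclideanSpace ℝ (Fin n) × EuclideanSpace ℝ (Fin n) |
          dist p.2 p.1 < 2 * s}.indicator (fun p => f p.2) := by
        funext p
        by_cases h : dist p.2 p.1 < 2 * s
        · rw [Set.indicator_of_mem (by exact h)]
          exact Set.indicator_of_mem (by exact h) _
        · rw [Set.indicator_of_notMem (by exact h)]
          exact Set.indicator_of_notMem (by exact h) _
      rw [this]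
      exact (hf.measurable.comp measurable_snd).indicator
        (measurableSet_lt (measurable_snd.dist measurable_fst) measurable_const)
    refine Integrable.of_bound hm.aestronglyMeasurable M (ae_of_all _ fun p => ?_)
    exact (norm_indicator_le_norm_self f p.2).trans (hM _)
  have h1 : ∀ᵐ x ∂ν, iterAvg j s f x ≤
      (volume.real (ball (0 : EuclideanSpace ℝ (Fin n)) s))⁻¹ * ∫ z in U, F x z := by
    filter_upwards [hνU] with x hx
    refine (iterAvg_le_integral j hf hs fun y hy => hfU y (hx hy)).trans (le_of_eq ?_)
    rw [hF]
    simp only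
    rw [setIntegral_indicator measurableSet_ball, Set.inter_eq_right.2 hx]
  refine (integral_mono_ae ((hf.iterAvg j hs).integrable ν)
    (hFint.integral_prod_left.const_mul _) h1).trans ?_
  rw [integral_const_mul]
  refine mul_le_mul_of_nonneg_left ?_ (by positivity)
  -- Since `z ∈ ball x (2 * s)` iff `x ∈ ball z (2 * s)`, integrating in `x` first leaves `ν (ball z
  -- (2 * s))` times `f z`.
  have hswap := integral_integral_swap hFint
  simp only [Function.uncurry_apply_pair] at hswap ⊢
  rw [hswap, ← integral_const_mul]
  refine setIntegral_mono_on hFint.integral_prod_right ((hf.integrableOn hUv).const_mul B) hU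
    fun z hz => ?_
  simp only [hFeq]
  rw [integral_indicator measurableSet_ball, setIntegral_const, smul_eq_mul]
  exact mul_le_mul_of_nonneg_right (hB z hz) (hfU z hz)

/-- Summing a geometric series of the differences of consecutive iterated means. -/
theorem integral_iterAvg_le_of_step {v : EuclideanSpace ℝ (Fin n) → ℝ} (hv : IsBddMeasurable v)
    (ν : Measure (EuclideanSpace ℝ (Fin n))) [IsFiniteMeasure ν] {ρ c α : ℝ} (hc : 0 ≤ c) (hα : 0 < α)
    (hstep : ∀ j s, 0 < s → s ≤ ρ →
      ∫ x, iterAvg j (s / 2) (fun y => ballAvg s v y - v y) x ∂ν ≤ c * s ^ α)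
    (j : ℕ) (hs : 0 < s) (hsρ : s ≤ ρ) :
    ∫ x, iterAvg j s v x ∂ν ≤
      ∫ x, ballAvg (s / 2 ^ j) v x ∂ν + c / (1 - (1 / 2) ^ α) * s ^ α := by
  have hq : (1 / 2 : ℝ) ^ α < 1 := Real.rpow_lt_one (by norm_num) (by norm_num) hα
  induction j generalizing s with
  | zero =>
    have : 0 ≤ c / (1 - (1 / 2) ^ α) * s ^ α := by
      have : 0 < 1 - (1 / 2 : ℝ) ^ α := by linarith
      positivity
    simpa [iterAvg] using this
  | succ j ih =>
    have h := hstep j s hs hsρ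
    simp only [← iterAvg_succ_sub j hv hs] at h
    rw [integral_sub ((hv.iterAvg _ hs).integrable _)
      ((hv.iterAvg _ (half_pos hs)).integrable _)] at h
    have h2 := ih (half_pos hs) (by linarith)
    have e : s / 2 / 2 ^ j = s / 2 ^ (j + 1) := by rw [pow_succ']; field_simp
    have e2 : (s / 2) ^ α = (1 / 2) ^ α * s ^ α := by
      rw [← Real.mul_rpow (by norm_num) hs.le]; congr 1; ring
    rw [e, e2] at h2
    -- The constant is the sum of the geometric series of ratio `(1 / 2) ^ α`, so it absorbs one
    -- more step exactly.
    have e3 : c / (1 - (1 / 2) ^ α) * ((1 / 2) ^ α * s ^ α) + c * s ^ α =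
        c / (1 - (1 / 2) ^ α) * s ^ α := by
      have : 1 - (1 / 2 : ℝ) ^ α ≠ 0 := by linarith
      field_simp
      ring
    linarith

end SmoothCutoff

/-! ### Bounded subharmonic functions, their local suprema, and the one-step estimate. -/

section Subharmonic

open Filter Topology

variable {n : ℕ} {Ω D K : Set (EuclideanSpace ℝ (Fin n))} {u : EuclideanSpace ℝ (Fin n) → ℝ}
  {δ M : ℝ}

/-- The distance from a point of `Ω` to the complement is attained on the frontier. -/
theorem ball_subset_of_mem_innerPart (hΩ : Ω ≠ Set.univ) {x : EuclideanSpace ℝ (Fin n)}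
    (hx : x ∈ innerPart Ω δ) : ball x δ ⊆ Ω := by
  obtain ⟨y, hy, hxy⟩ := exists_mem_frontier_infDist_compl_eq_dist hx.1 hΩ
  intro w hw
  by_contra hwΩ
  have h1 : infDist x Ωᶜ ≤ dist x w := infDist_le_dist_of_mem hwΩ
  have h2 : infDist x (frontier Ω) ≤ dist x y := infDist_le_dist_of_mem hy
  have h3 := hx.2
  rw [mem_ball, dist_comm] at hw
  linarith

theorem exists_forall_le_of_mem_innerPart (hΩ : Bornology.IsBounded Ω) :
    ∃ R : ℝ, ∀ δ, 0 < δ → (innerPart Ω δ).Nonempty → δ ≤ R := by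
  refine ⟨diam (closure Ω), fun δ hδ ⟨x, hx, hxδ⟩ => ?_⟩
  rcases (frontier Ω).eq_empty_or_nonempty with h | ⟨y, hy⟩
  -- `infDist` to the empty set is `0`, which contradicts `0 < δ`.
  · rw [h, infDist_empty] at hxδ
    linarith
  · exact hxδ.le.trans ((infDist_le_dist_of_mem hy).trans
      (dist_le_diam_of_mem hΩ.closure (subset_closure hx) (frontier_subset_closure hy)))

/-- An almost everywhere bound must hold everywhere because `μ` may charge Lebesgue-null sets.
Semicontinuity spreads `u x < -M` to a ball of positive volume; the upper bound is the sub-mean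
inequality. -/
theorem IsSubharmonicOn.abs_le (hu : IsSubharmonicOn u Ω) (hΩ : IsOpen Ω)
    (hM : ∀ᵐ x ∂(volume.restrict Ω), |u x| ≤ M) {x : EuclideanSpace ℝ (Fin n)} (hx : x ∈ Ω) :
    |u x| ≤ M := by
  rw [_root_.abs_le]
  constructor
  · by_contra! h
    have h1 : ∀ᶠ y in 𝓝 x, u y < -M := by
      have := hu.upperSemicontinuousOn x hx _ h
      rwa [hΩ.nhdsWithin_eq hx] at this
    obtain ⟨r, hr, hrs⟩ := Metric.eventually_nhds_iff_ball.1 (h1.and (hΩ.mem_nhds hx))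
    have h2 : volume (ball x r) ≤ 0 := by
      rw [ae_restrict_iff' hΩ.measurableSet] at hM
      refine (measure_mono fun y hy => ?_).trans (le_of_eq hM)
      intro hcon
      exact absurd (hcon (hrs y hy).2) (not_le.2 (lt_abs.2 (Or.inr (by linarith [(hrs y hy).1]))))
    exact absurd h2 (not_le.2 (measure_ball_pos _ _ hr))
  · obtain ⟨r, hr, hrs⟩ := Metric.nhds_basis_closedBall.mem_iff.1 (hΩ.mem_nhds hx)
    refine (hu.le_average_ball x r hr hrs).trans ?_
    have hV := volume_real_ball_pos x hr
    rw [setAverage_eq, smul_eq_mul, inv_mul_le_iff₀ hV]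
    calc ∫ y in ball x r, u y ≤ ∫ _ in ball x r, M := by
          refine integral_mono_ae (hu.integrableOn_ball x r hr hrs)
            (integrableOn_const measure_ball_lt_top.ne) ?_
          filter_upwards [ae_restrict_of_ae_restrict_of_subset (ball_subset_closedBall.trans hrs) hM]
            with y hy using (le_abs_self _).trans hy
      _ = volume.real (ball x r) * M := by rw [setIntegral_const, smul_eq_mul]

theorem IsSubharmonicOn.isBddMeasurable_indicator (hu : IsSubharmonicOn u Ω) (hΩ : IsOpen Ω)
    (hM : ∀ x ∈ Ω, |u x| ≤ M) : IsBddMeasurable (Ω.indicator u) := by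
  constructor
  · have h1 : Measurable (fun x : Ω => u x) :=
      (upperSemicontinuousOn_iff_restrict.2 hu.upperSemicontinuousOn).measurable
    refine measurable_of_restrict_of_restrict_compl hΩ.measurableSet ?_ ?_
    · convert h1 using 2 with x
      exact Set.indicator_of_mem x.2 u
    · convert measurable_const (a := (0 : ℝ)) using 2 with x
      exact Set.indicator_of_notMem x.2 u
  · refine ⟨|M|, fun x => ?_⟩
    by_cases hx : x ∈ Ω
    · rw [Set.indicator_of_mem hx]
      exact (hM x hx).trans (le_abs_self M)
    · rw [Set.indicator_of_notMem hx, abs_zero]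
      exact abs_nonneg M

theorem IsSubharmonicOn.indicator_le_ballAvg (hu : IsSubharmonicOn u Ω)
    {x : EuclideanSpace ℝ (Fin n)} {r : ℝ} (hr : 0 < r) (hx : closedBall x r ⊆ Ω) :
    Ω.indicator u x ≤ ballAvg r (Ω.indicator u) x := by
  rw [Set.indicator_of_mem (hx (mem_closedBall_self hr.le)), ballAvg_eq_average]
  refine (hu.le_average_ball x r hr hx).trans (le_of_eq ?_)
  rw [setAverage_eq, setAverage_eq]
  congr 1
  exact setIntegral_congr_fun measurableSet_ball fun y hy =>
    (Set.indicator_of_mem (hx (ball_subset_closedBall hy)) u).symm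

/-- The sub-mean inequality bounds the means from below, upper semicontinuity from above.
Convergence at every point is what a singular `μ` requires. -/
theorem IsSubharmonicOn.tendsto_ballAvg (hu : IsSubharmonicOn u Ω) (hΩ : IsOpen Ω)
    (hM : ∀ x ∈ Ω, |u x| ≤ M) {x : EuclideanSpace ℝ (Fin n)} (hx : x ∈ Ω) :
    Tendsto (fun r => ballAvg r (Ω.indicator u) x) (𝓝[>] 0) (𝓝 (Ω.indicator u x)) := by
  have hv := hu.isBddMeasurable_indicator hΩ hM
  rw [tendsto_order]
  obtain ⟨ρ, hρ, hρs⟩ := Metric.nhds_basis_closedBall.mem_iff.1 (hΩ.mem_nhds hx)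
  constructor
  · intro a ha
    filter_upwards [Ioo_mem_nhdsGT hρ] with r hr
    exact ha.trans_le (hu.indicator_le_ballAvg hr.1 ((closedBall_subset_closedBall hr.2.le).trans hρs))
  · intro a ha
    obtain ⟨b, hb, hba⟩ := exists_between ha
    have h1 : ∀ᶠ y in 𝓝 x, u y < b := by
      rw [Set.indicator_of_mem hx] at hb
      have := hu.upperSemicontinuousOn x hx _ hb
      rwa [hΩ.nhdsWithin_eq hx] at this
    obtain ⟨r₀, hr₀, hrs⟩ := Metric.eventually_nhds_iff_ball.1 (h1.and (hΩ.mem_nhds hx))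
    filter_upwards [Ioo_mem_nhdsGT hr₀] with r hr
    refine lt_of_le_of_lt ?_ hba
    rw [← ballAvg_const b hr.1 x]
    refine ballAvg_mono_on hv (.const b) hr.1 fun y hy => ?_
    have := hrs y (ball_subset_ball hr.2.le hy)
    rw [Set.indicator_of_mem this.2]
    exact this.1.le

theorem nonempty_image_ball (hδ : 0 < δ) (x : EuclideanSpace ℝ (Fin n)) :
    ((fun y => u (x + y)) '' ball 0 δ).Nonempty :=
  ⟨_, 0, mem_ball_self hδ, rfl⟩

theorem add_mem_ball_of_mem_ball_zero {x y : EuclideanSpace ℝ (Fin n)} (hy : y ∈ ball 0 δ) :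
    x + y ∈ ball x δ := by
  simpa using hy

theorem bddAbove_image_ball (hM : ∀ x ∈ Ω, |u x| ≤ M) {x : EuclideanSpace ℝ (Fin n)}
    (hx : ball x δ ⊆ Ω) : BddAbove ((fun y => u (x + y)) '' ball 0 δ) := by
  refine ⟨M, ?_⟩
  rintro _ ⟨y, hy, rfl⟩
  exact (le_abs_self _).trans (hM _ (hx (add_mem_ball_of_mem_ball_zero hy)))

theorem le_ballSup (hM : ∀ x ∈ Ω, |u x| ≤ M) {x : EuclideanSpace ℝ (Fin n)} (hδ : 0 < δ)
    (hx : ball x δ ⊆ Ω) : u x ≤ ballSup u δ x :=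
  le_csSup (bddAbove_image_ball hM hx) ⟨0, mem_ball_self hδ, by simp⟩

theorem abs_ballSup_le (hM : ∀ x ∈ Ω, |u x| ≤ M) {x : EuclideanSpace ℝ (Fin n)} (hδ : 0 < δ)
    (hx : ball x δ ⊆ Ω) : |ballSup u δ x| ≤ M := by
  refine _root_.abs_le.2 ⟨?_, csSup_le (nonempty_image_ball hδ x) ?_⟩
  · exact (_root_.abs_le.1 (hM x (hx (mem_ball_self hδ)))).1.trans (le_ballSup hM hδ hx)
  · rintro _ ⟨y, hy, rfl⟩
    exact (le_abs_self _).trans (hM _ (hx (add_mem_ball_of_mem_ball_zero hy)))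

theorem integrableOn_ballSup (hM : ∀ x ∈ Ω, |u x| ≤ M) (hδ : 0 < δ) (hKm : MeasurableSet K)
    (hK : ∀ x ∈ K, ball x δ ⊆ Ω) {μ : Measure (EuclideanSpace ℝ (Fin n))} (hμ : μ K < ⊤) :
    IntegrableOn (ballSup u δ) K μ := by
  have h1 : Measurable (fun x : K => ballSup u δ x) := by
    refine measurable_of_Ioi fun c => ?_
    -- Superlevel sets of the supremum are traces on `K` of unions of open balls, hence Borel.
    have : (fun x : K => ballSup u δ x) ⁻¹' Set.Ioi c =
        Subtype.val ⁻¹' ⋃ z ∈ {z | c < u z}, ball z δ := by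
      ext ⟨x, hx⟩
      simp only [Set.mem_preimage, Set.mem_Ioi, Set.mem_iUnion, Set.mem_ofPred_eq, exists_prop]
      rw [ballSup, lt_csSup_iff (bddAbove_image_ball hM (hK x hx)) (nonempty_image_ball hδ x)]
      constructor
      · rintro ⟨_, ⟨y, hy, rfl⟩, hc⟩
        exact ⟨x + y, hc, mem_ball_comm.1 (add_mem_ball_of_mem_ball_zero hy)⟩
      · rintro ⟨z, hz, hxz⟩
        refine ⟨u z, ⟨z - x, ?_, by simp⟩, hz⟩
        rw [mem_ball_comm] at hxz
        rwa [mem_ball_zero_iff, ← dist_eq_norm]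
    rw [this]
    exact measurable_subtype_coe (isOpen_biUnion fun z _ => isOpen_ball).measurableSet
  refine IntegrableOn.of_bound hμ
    (aemeasurable_restrict_of_measurable_subtype hKm h1).aestronglyMeasurable M ?_
  filter_upwards [ae_restrict_mem hKm] with x hx using abs_ballSup_le hM hδ (hK x hx)

/-- A finite cover of `closure K` by balls in `D` is fixed before `μ`, so the bound is uniform in
`μ`. -/
theorem exists_measure_bound (hDo : IsOpen D) (hKD : CompactlyContained K D) (A β : ℝ)
    (hA : 0 < A) :
    ∃ m : ℝ, 0 ≤ m ∧ ∀ μ : Measure (EuclideanSpace ℝ (Fin n)),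
      (∀ z r, 0 < r → ball z r ⊆ D → μ (ball z r) ≤ ENNReal.ofReal (A * r ^ β)) →
      μ K ≤ ENNReal.ofReal m := by
  obtain ⟨ρ, hρ, hρD⟩ := hKD.1.exists_cthickening_subset_open hDo hKD.2
  obtain ⟨t, htK, htf, ht⟩ := hKD.1.finite_cover_balls hρ
  refine ⟨htf.toFinset.card * (A * ρ ^ β), by positivity, fun μ hμ => ?_⟩
  have hb : ∀ x ∈ htf.toFinset, μ (ball x ρ) ≤ ENNReal.ofReal (A * ρ ^ β) := fun x hx => by
    refine hμ x ρ hρ ((ball_subset_thickening (htK (htf.mem_toFinset.1 hx)) ρ).trans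
      ((thickening_subset_cthickening _ _).trans hρD))
  calc μ K ≤ μ (⋃ x ∈ htf.toFinset, ball x ρ) :=
        measure_mono (subset_closure.trans (by simpa using ht))
    _ ≤ ∑ x ∈ htf.toFinset, μ (ball x ρ) := measure_biUnion_finset_le _ _
    _ ≤ ∑ x ∈ htf.toFinset, ENNReal.ofReal (A * ρ ^ β) := Finset.sum_le_sum hb
    _ = ENNReal.ofReal (htf.toFinset.card * (A * ρ ^ β)) := by
        rw [Finset.sum_const, nsmul_eq_mul, ENNReal.ofReal_mul (Nat.cast_nonneg _),
          ENNReal.ofReal_natCast]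

theorem closedBall_subset_of_mem_thickening {ρ s : ℝ} (hρ : cthickening (3 * ρ) K ⊆ D)
    (hs : s ≤ ρ) {z : EuclideanSpace ℝ (Fin n)} (hz : z ∈ thickening (2 * ρ) K) :
    closedBall z s ⊆ D := by
  obtain ⟨k, hk, hzk⟩ := mem_thickening_iff.1 hz
  intro w hw
  refine hρ (mem_cthickening_of_dist_le w k _ _ hk ?_)
  rw [mem_closedBall] at hw
  linarith [dist_triangle w z k]

/-- One step of the dyadic comparison of iterated means, integrated over `K`. -/
theorem exists_step_bound (hΩ : IsOpen Ω) (hΩb : Bornology.IsBounded Ω) (hDΩ : D ⊆ Ω)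
    (hKm : MeasurableSet K) (hKb : Bornology.IsBounded K) {ρ : ℝ} (hρ : 0 < ρ)
    (hρD : cthickening (3 * ρ) K ⊆ D) {A : ℝ} (hA : 0 < A) (α : ℝ) :
    ∃ c : ℝ, 0 ≤ c ∧ ∀ μ : Measure (EuclideanSpace ℝ (Fin n)), μ K < ⊤ →
      (∀ z r, 0 < r → ball z r ⊆ D →
        μ (ball z r) ≤ ENNReal.ofReal (A * r ^ ((n : ℝ) - 2 + α))) →
      ∀ (v : EuclideanSpace ℝ (Fin n) → ℝ) (M : ℝ), IsBddMeasurable v → (∀ x, |v x| ≤ M) →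
        (∀ x ∉ Ω, v x = 0) →
        (∀ x r, 0 < r → closedBall x r ⊆ Ω → v x ≤ ballAvg r v x) →
        ∀ (j : ℕ) (s : ℝ), 0 < s → s ≤ ρ →
          ∫ x in K, iterAvg j (s / 2) (fun y => ballAvg s v y - v y) x ∂μ ≤ c * M * s ^ α := by
  obtain ⟨χ, hχ, hχc, hχ0, hχ1, hχs⟩ := exists_cutoff hKb hρ
  obtain ⟨L, hL0, hL⟩ := exists_abs_secondDiff_le hχ hχc
  set V := volume.real (ball (0 : EuclideanSpace ℝ (Fin n)) 1) with hV
  have hV0 : 0 < V := volume_real_ball_pos _ one_pos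
  refine ⟨2 ^ n / V * A * L * volume.real Ω, by positivity,
    fun μ hμK hμ v M hv hvM hvΩ hsub j s hs hsρ => ?_⟩
  have hfin : IsFiniteMeasure (μ.restrict K) := ⟨by simpa using hμK⟩
  have hUb : volume (thickening ρ K) < ⊤ := hKb.thickening.measure_lt_top
  have hs2 : 2 * (s / 2) = s := by ring
  have hball : ∀ z ∈ thickening (2 * ρ) K, closedBall z s ⊆ D := fun z hz =>
    closedBall_subset_of_mem_thickening hρD hsρ hz
  have hUU : thickening ρ K ⊆ thickening (2 * ρ) K := thickening_mono (by linarith) K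
  have hh : IsBddMeasurable (fun y => ballAvg s v y - v y) := (hv.ballAvg hs).sub hv
  have hh0 : ∀ z ∈ thickening (2 * ρ) K, 0 ≤ ballAvg s v z - v z := fun z hz =>
    sub_nonneg.2 (hsub z s hs ((hball z hz).trans hDΩ))
  have h1 := integral_iterAvg_le j hh (half_pos hs) (μ.restrict K)
    (U := thickening ρ K) isOpen_thickening.measurableSet hUb
    (by filter_upwards [ae_restrict_mem hKm] with x hx
        rw [hs2]
        exact (ball_subset_ball hsρ).trans (ball_subset_thickening hx ρ))
    (fun z hz => hh0 z (hUU hz)) (B := A * s ^ ((n : ℝ) - 2 + α))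
    (fun z hz => by
      rw [hs2]
      refine ENNReal.toReal_le_of_le_ofReal (by positivity) ?_
      exact (Measure.restrict_apply_le _ _).trans
        (hμ z s hs (ball_subset_closedBall.trans (hball z (hUU hz)))))
  refine h1.trans ?_
  have h2 : ∫ z in thickening ρ K, (ballAvg s v z - v z) ≤ L * volume.real Ω * M * s ^ 2 := by
    refine le_trans ?_ (integral_ballAvg_sub_mul_le hv hs hvM hΩb.measure_lt_top hΩ.measurableSet
      hvΩ hχ.continuous hχc hL0 hL)
    obtain ⟨N, hN⟩ := hh.bounded
    have hi : Integrable (fun x => (ballAvg s v x - v x) * χ x) :=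
      (hχ.continuous.integrable_of_hasCompactSupport hχc).bdd_mul (c := N)
        hh.measurable.aestronglyMeasurable (ae_of_all _ hN)
    -- Inserting `χ` only enlarges the integral: `χ` is `1` on the small thickening, and the
    -- integrand is nonnegative wherever `χ` does not vanish.
    calc ∫ z in thickening ρ K, (ballAvg s v z - v z)
        = ∫ z in thickening ρ K, (ballAvg s v z - v z) * χ z :=
          setIntegral_congr_fun isOpen_thickening.measurableSet fun z hz => by
            simp [hχ1 z hz]
      _ ≤ ∫ z, (ballAvg s v z - v z) * χ z := by
          refine setIntegral_le_integral hi (ae_of_all _ fun z => ?_)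
          by_cases hz : z ∈ thickening (2 * ρ) K
          · exact mul_nonneg (hh0 z hz) (hχ0 z)
          · simp [hχs z hz]
  have e : s ^ ((n : ℝ) - 2 + α) * s ^ 2 = s ^ n * s ^ α := by
    rw [← Real.rpow_natCast s 2, ← Real.rpow_natCast s n, ← Real.rpow_add hs, ← Real.rpow_add hs]
    congr 1
    push_cast
    ring
  rw [volume_real_ball _ (half_pos hs), ← hV]
  calc ((s / 2) ^ n * V)⁻¹ * (A * s ^ ((n : ℝ) - 2 + α) *
        ∫ z in thickening ρ K, (ballAvg s v z - v z))
      ≤ ((s / 2) ^ n * V)⁻¹ * (A * s ^ ((n : ℝ) - 2 + α) * (L * volume.real Ω * M * s ^ 2)) := by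
        gcongr
    _ = ((s / 2) ^ n * V)⁻¹ * (A * (s ^ ((n : ℝ) - 2 + α) * s ^ 2) * L * volume.real Ω * M) := by
        ring
    _ = 2 ^ n / V * A * L * volume.real Ω * M * s ^ α := by
        rw [e, div_pow]
        field_simp

end Subharmonic

/-! ### Choice of the scale and conclusion. -/

section Main

open Filter Topology

variable {n : ℕ} {Ω D K : Set (EuclideanSpace ℝ (Fin n))} {u : EuclideanSpace ℝ (Fin n) → ℝ}
  {δ M : ℝ}

theorem IsSubharmonicOn.ballSup_le_iterAvg (hu : IsSubharmonicOn u Ω) (hΩ : IsOpen Ω)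
    (hM : ∀ x ∈ Ω, |u x| ≤ M) (hM0 : 0 ≤ M) (hδ : 0 < δ) {s ρ : ℝ} (hs : 0 < s) (hsρ : s ≤ ρ)
    (hδρ : δ ≤ ρ) {x : EuclideanSpace ℝ (Fin n)} (hx : closedBall x (3 * ρ) ⊆ Ω) (j : ℕ) :
    ballSup u δ x ≤ iterAvg j s (Ω.indicator u) x + 2 * n * M / s * δ := by
  have hv := hu.isBddMeasurable_indicator hΩ hM
  have hvM : ∀ x, |Ω.indicator u x| ≤ M := fun z => by
    by_cases hz : z ∈ Ω
    · rw [Set.indicator_of_mem hz]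
      exact hM z hz
    · rw [Set.indicator_of_notMem hz, abs_zero]
      exact hM0
  refine csSup_le (nonempty_image_ball hδ x) ?_
  rintro _ ⟨y, hy, rfl⟩
  have hxy := add_mem_ball_of_mem_ball_zero (x := x) hy
  rw [mem_ball] at hxy
  have hmem : x + y ∈ Ω := hx (by rw [mem_closedBall]; linarith)
  have h1 : Ω.indicator u (x + y) ≤ iterAvg j s (Ω.indicator u) (x + y) := by
    refine le_iterAvg j hv hs fun z hz t ht _ hzt => hu.indicator_le_ballAvg ht fun w hw => hx ?_
    rw [mem_closedBall] at *
    linarith [dist_triangle w z x, dist_triangle z (x + y) x]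
  have h2 := iterAvg_sub_le_of_bounded j hv hs hvM (x + y) x
  have h3 : 2 * n * M / s * dist (x + y) x ≤ 2 * n * M / s * δ := by gcongr
  rw [Set.indicator_of_mem hmem] at h1
  linarith

theorem IsSubharmonicOn.tendsto_setIntegral_ballAvg (hu : IsSubharmonicOn u Ω) (hΩ : IsOpen Ω)
    (hM : ∀ x ∈ Ω, |u x| ≤ M) (hKm : MeasurableSet K) (hK : K ⊆ Ω)
    {μ : Measure (EuclideanSpace ℝ (Fin n))} (hμ : μ K < ⊤) {s : ℝ} (hs : 0 < s) :
    Tendsto (fun j : ℕ => ∫ x in K, ballAvg (s / 2 ^ j) (Ω.indicator u) x ∂μ) atTop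
      (𝓝 (∫ x in K, Ω.indicator u x ∂μ)) := by
  have hfin : IsFiniteMeasure (μ.restrict K) := ⟨by simpa using hμ⟩
  have hv := hu.isBddMeasurable_indicator hΩ hM
  obtain ⟨N, hN⟩ := hv.bounded
  have hpos : ∀ j : ℕ, 0 < s / 2 ^ j := fun j => by positivity
  have hlim : Tendsto (fun j : ℕ => s / 2 ^ j) atTop (𝓝[>] 0) := by
    refine tendsto_nhdsWithin_iff.2 ⟨?_, Eventually.of_forall hpos⟩
    have := (tendsto_pow_atTop_nhds_zero_of_lt_one (r := (1 / 2 : ℝ)) (by norm_num)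
      (by norm_num)).const_mul s
    rw [mul_zero] at this
    refine this.congr fun j => ?_
    rw [one_div, inv_pow, div_eq_mul_inv]
  refine tendsto_integral_of_dominated_convergence (fun _ => N)
    (fun j => (hv.ballAvg (hpos j)).measurable.aestronglyMeasurable) (integrable_const _)
    (fun j => ae_of_all _ (abs_ballAvg_le hv (hpos j) hN)) ?_
  filter_upwards [ae_restrict_mem hKm] with x hx
  exact (hu.tendsto_ballAvg hΩ hM (hK hx)).comp hlim

/-- The estimate for small `δ`, with the better exponent `α / (1 + α)`. -/
theorem exists_bound_of_small (hΩ : IsOpen Ω) (hΩb : Bornology.IsBounded Ω)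
    (hDo : IsOpen D) (hDΩ : D ⊆ Ω) (hKm : MeasurableSet K) (hKD : CompactlyContained K D)
    {A α : ℝ} (hA : 0 < A) (hα : 0 < α) :
    ∃ δ₀ > 0, δ₀ ≤ 1 ∧ ∃ C : ℝ, 0 ≤ C ∧ ∀ μ : Measure (EuclideanSpace ℝ (Fin n)),
      (∀ z r, 0 < r → ball z r ⊆ D →
        μ (ball z r) ≤ ENNReal.ofReal (A * r ^ ((n : ℝ) - 2 + α))) →
      ∀ u : EuclideanSpace ℝ (Fin n) → ℝ, IsSubharmonicOn u Ω →
        ∀ M : ℝ, 0 ≤ M → (∀ x ∈ Ω, |u x| ≤ M) →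
        ∀ δ : ℝ, 0 < δ → δ ≤ δ₀ →
          ∫ x in K, (ballSup u δ x - u x) ∂μ ≤ C * M * δ ^ (α / (1 + α)) := by
  obtain ⟨m, hm0, hm⟩ := exists_measure_bound hDo hKD A ((n : ℝ) - 2 + α) hA
  obtain ⟨ρ', hρ', hρD'⟩ := hKD.1.exists_cthickening_subset_open hDo hKD.2
  obtain ⟨ρ, hρ, rfl⟩ : ∃ ρ, 0 < ρ ∧ 3 * ρ = ρ' := ⟨ρ' / 3, by linarith, by ring⟩
  rw [cthickening_closure] at hρD'
  have hKb : Bornology.IsBounded K := hKD.1.isBounded.subset subset_closure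
  obtain ⟨c, hc0, hc⟩ := exists_step_bound hΩ hΩb hDΩ hKm hKb hρ hρD' hA α
  have hα1 : 0 < 1 + α := by linarith
  have hq : 0 < 1 - (1 / 2 : ℝ) ^ α :=
    sub_pos.2 (Real.rpow_lt_one (by norm_num) (by norm_num) hα)
  -- The last two entries give `δ ≤ ρ` and `s ≤ ρ`; the bound by `1` serves the later comparison of
  -- exponents.
  refine ⟨min 1 (min ρ (ρ ^ (1 + α))), by positivity, min_le_left _ _,
    c / (1 - (1 / 2) ^ α) + 2 * n * m, by positivity,
    fun μ hμ u hu M hM0 hM δ hδ hδ₀ => ?_⟩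
  have hδρ : δ ≤ ρ := hδ₀.trans ((min_le_right _ _).trans (min_le_left _ _))
  -- This scale balances the two errors: `s ^ α = δ / s`.
  set s := δ ^ (1 / (1 + α)) with hs_def
  have hs : 0 < s := by positivity
  have hsρ : s ≤ ρ := by
    have : δ ≤ ρ ^ (1 + α) := hδ₀.trans ((min_le_right _ _).trans (min_le_right _ _))
    calc s ≤ (ρ ^ (1 + α)) ^ (1 / (1 + α)) := by rw [hs_def]; gcongr
      _ = ρ := by rw [← Real.rpow_mul hρ.le, mul_one_div_cancel hα1.ne', Real.rpow_one]
  have hsα : s ^ α = δ ^ (α / (1 + α)) := by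
    rw [hs_def, ← Real.rpow_mul hδ.le]
    congr 1
    ring
  have hsδ : δ / s = δ ^ (α / (1 + α)) := by
    rw [div_eq_iff hs.ne', hs_def, ← Real.rpow_add hδ, ← add_div, add_comm α, div_self hα1.ne',
      Real.rpow_one]
  have hμm := hm μ hμ
  have hμK : μ K < ⊤ := hμm.trans_lt ENNReal.ofReal_lt_top
  have hμr : (μ.restrict K).real Set.univ ≤ m := by
    rw [measureReal_restrict_apply_univ]
    exact ENNReal.toReal_le_of_le_ofReal hm0 hμm
  have hfin : IsFiniteMeasure (μ.restrict K) := ⟨by simpa using hμK⟩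
  have hball : ∀ x ∈ K, closedBall x (3 * ρ) ⊆ Ω := fun x hx =>
    ((closedBall_subset_cthickening hx _).trans hρD').trans hDΩ
  have hKΩ : K ⊆ Ω := fun x hx => hball x hx (mem_closedBall_self (by linarith))
  set v := Ω.indicator u with hv_def
  have hv : IsBddMeasurable v := hu.isBddMeasurable_indicator hΩ hM
  have hvM : ∀ x, |v x| ≤ M := fun z => by
    by_cases hz : z ∈ Ω
    · rw [hv_def, Set.indicator_of_mem hz]
      exact hM z hz
    · rw [hv_def, Set.indicator_of_notMem hz, abs_zero]
      exact hM0
  have hsup : Integrable (ballSup u δ) (μ.restrict K) :=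
    integrableOn_ballSup hM hδ hKm
      (fun x hx => (ball_subset_closedBall.trans (closedBall_subset_closedBall (by linarith))).trans
        (hball x hx)) hμK
  have huv : ∫ x in K, u x ∂μ = ∫ x in K, v x ∂μ :=
    setIntegral_congr_fun hKm fun x hx => (Set.indicator_of_mem (hKΩ hx) u).symm
  have hui : Integrable u (μ.restrict K) :=
    (hv.integrable (μ.restrict K)).congr (by
      filter_upwards [ae_restrict_mem hKm] with x hx using Set.indicator_of_mem (hKΩ hx) u)
  have hstep := hc μ hμK hμ v M hv hvM (fun x hx => Set.indicator_of_notMem hx u)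
    fun x r hr hx => hu.indicator_le_ballAvg hr hx
  have hj : ∀ j : ℕ, ∫ x in K, ballSup u δ x ∂μ ≤
      ∫ x in K, ballAvg (s / 2 ^ j) v x ∂μ + (c * M / (1 - (1 / 2) ^ α) * s ^ α +
        2 * n * M / s * δ * m) := by
    intro j
    have h1 := integral_iterAvg_le_of_step hv (μ.restrict K) (mul_nonneg hc0 hM0) hα hstep j hs hsρ
    have h2 : ∫ x in K, ballSup u δ x ∂μ ≤
        ∫ x in K, (iterAvg j s v x + 2 * n * M / s * δ) ∂μ := by
      refine integral_mono_ae hsup (((hv.iterAvg j hs).integrable _).add (integrable_const _)) ?_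
      filter_upwards [ae_restrict_mem hKm] with x hx
      exact hu.ballSup_le_iterAvg hΩ hM hM0 hδ hs hsρ hδρ (hball x hx) j
    rw [integral_add ((hv.iterAvg j hs).integrable _) (integrable_const _), integral_const,
      smul_eq_mul, mul_comm _ (2 * n * M / s * δ)] at h2
    have h3 : 2 * n * M / s * δ * (μ.restrict K).real Set.univ ≤ 2 * n * M / s * δ * m := by gcongr
    linarith
  -- The error terms are independent of `j`, so they survive the limit unchanged.
  have hlim := ge_of_tendsto' ((hu.tendsto_setIntegral_ballAvg hΩ hM hKm hKΩ hμK hs).add_const _) hj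
  rw [integral_sub hsup hui, huv]
  have e : c * M / (1 - (1 / 2) ^ α) * s ^ α + 2 * n * M / s * δ * m =
      (c / (1 - (1 / 2) ^ α) + 2 * n * m) * M * δ ^ (α / (1 + α)) := by
    rw [show 2 * n * M / s * δ * m = 2 * n * M * m * (δ / s) by ring, hsδ, hsα]
    ring
  rw [← e]
  linarith

/-- Both signs of `γ` are needed, since `ε` may exceed `α`; for `γ < 0` the upper bound `R` matters.
-/
theorem exists_rpow_lower_bound {a : ℝ} (ha : 0 < a) (R γ : ℝ) :
    ∃ q > 0, ∀ δ, a ≤ δ → δ ≤ R → q ≤ δ ^ γ := by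
  rcases le_or_gt 0 γ with h | h
  · exact ⟨a ^ γ, by positivity, fun δ h1 _ => Real.rpow_le_rpow ha.le h1 h⟩
  · refine ⟨max a R ^ γ, by positivity, fun δ h1 h2 => ?_⟩
    exact Real.rpow_le_rpow_of_nonpos (ha.trans_le h1) (h2.trans (le_max_right _ _)) h.le

end Main

theorem theorem4p2 (n : ℕ) (hn : 2 ≤ n)
    (Ω D K : Set (EuclideanSpace ℝ (Fin n)))
    (hΩo : IsOpen Ω) (hΩc : IsConnected Ω) (hΩb : Bornology.IsBounded Ω)
    (hDo : IsOpen D) (hDΩ : CompactlyContained D Ω)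
    (hKm : MeasurableSet K) (hKD : CompactlyContained K D)
    (A α ε : ℝ) (hA : 0 < A) (hα : 0 < α) (hε : 0 < ε) :
    ∃ C : ℝ, ∀ μ : Measure (EuclideanSpace ℝ (Fin n)), IsRadonOn μ Ω →
      (∀ z r, 0 < r → ball z r ⊆ D →
        μ (ball z r) ≤ ENNReal.ofReal (A * r ^ ((n : ℝ) - 2 + α))) →
      ∀ u : EuclideanSpace ℝ (Fin n) → ℝ, IsSubharmonicOn u Ω →
        MemLp u ⊤ (volume.restrict Ω) →
        ∀ δ : ℝ, 0 < δ → K ⊆ innerPart Ω δ →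
          IntegrableOn (fun x => ballSup u δ x - u x) K μ ∧
          ∫ x in K, (ballSup u δ x - u x) ∂μ ≤
            C * (eLpNorm u ⊤ (volume.restrict Ω)).toReal *
              δ ^ ((α - ε) / (2 * (1 + α))) := by
  have hDΩ' : D ⊆ Ω := subset_closure.trans hDΩ.2
  obtain ⟨m, hm0, hm⟩ := exists_measure_bound hDo hKD A ((n : ℝ) - 2 + α) hA
  obtain ⟨δ₀, hδ₀, hδ₀1, C₁, hC₁, hsmall⟩ :=
    exists_bound_of_small hΩo hΩb hDo hDΩ' hKm hKD hA hα
  obtain ⟨R, hR⟩ := exists_forall_le_of_mem_innerPart hΩb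
  set γ := (α - ε) / (2 * (1 + α)) with hγ
  obtain ⟨q, hq, hqδ⟩ := exists_rpow_lower_bound hδ₀ R γ
  -- `C₁` handles `δ ≤ δ₀`; `2 * m / q` handles larger `δ`, where the integral is at most `2 * M *
  -- m` and `q ≤ δ ^ γ`.
  refine ⟨C₁ + 2 * m / q, fun μ _ hμ u hu huM δ hδ hKδ => ?_⟩
  set M := (eLpNorm u ⊤ (volume.restrict Ω)).toReal with hM_def
  have hM0 : 0 ≤ M := ENNReal.toReal_nonneg
  have hae : ∀ᵐ x ∂(volume.restrict Ω), |u x| ≤ M := by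
    have hlt : eLpNormEssSup u (volume.restrict Ω) ≠ ⊤ := by
      simpa [eLpNorm_exponent_top] using huM.eLpNorm_ne_top
    filter_upwards [ae_le_eLpNormEssSup (f := u) (μ := volume.restrict Ω)] with x hx
    have := ENNReal.toReal_mono hlt hx
    rwa [toReal_enorm, Real.norm_eq_abs, ← eLpNorm_exponent_top] at this
  have hM : ∀ x ∈ Ω, |u x| ≤ M := fun x hx => hu.abs_le hΩo hae hx
  have hKΩ : K ⊆ Ω := fun x hx => (hKδ hx).1
  have hne : Ω ≠ Set.univ := by
    rintro rfl
    have : Nontrivial (EuclideanSpace ℝ (Fin n)) := by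
      have : Nonempty (Fin n) := ⟨⟨0, by omega⟩⟩
      infer_instance
    exact NormedSpace.unbounded_univ ℝ (EuclideanSpace ℝ (Fin n)) hΩb
  have hball : ∀ x ∈ K, ball x δ ⊆ Ω := fun x hx => ball_subset_of_mem_innerPart hne (hKδ hx)
  have hμm := hm μ hμ
  have hμK : μ K < ⊤ := hμm.trans_lt ENNReal.ofReal_lt_top
  have hfin : IsFiniteMeasure (μ.restrict K) := ⟨by simpa using hμK⟩
  have hui : IntegrableOn u K μ :=
    ((hu.isBddMeasurable_indicator hΩo hM).integrable (μ.restrict K)).congr (by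
      filter_upwards [ae_restrict_mem hKm] with x hx using Set.indicator_of_mem (hKΩ hx) u)
  have hint : IntegrableOn (fun x => ballSup u δ x - u x) K μ :=
    (integrableOn_ballSup hM hδ hKm hball hμK).sub hui
  refine ⟨hint, ?_⟩
  have hδγ : 0 < δ ^ γ := by positivity
  rcases le_or_gt δ δ₀ with h | h
  · have h1 : δ ^ (α / (1 + α)) ≤ δ ^ γ := by
      refine Real.rpow_le_rpow_of_exponent_ge hδ (h.trans hδ₀1) ?_
      rw [hγ, div_le_div_iff₀ (by positivity) (by positivity)]
      nlinarith [mul_pos hα hα]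
    calc _ ≤ C₁ * M * δ ^ (α / (1 + α)) := hsmall μ hμ u hu M hM0 hM δ hδ h
      _ ≤ (C₁ + 2 * m / q) * M * δ ^ γ := by
        gcongr
        exact le_add_of_nonneg_right (by positivity)
  · rcases K.eq_empty_or_nonempty with hK | ⟨x₀, hx₀⟩
    · rw [hK, setIntegral_empty]
      positivity
    · have hδR := hR δ hδ ⟨x₀, hKδ hx₀⟩
      have h1 : ∫ x in K, (ballSup u δ x - u x) ∂μ ≤ (M + M) * μ.real K := by
        refine (le_abs_self _).trans (norm_setIntegral_le_of_norm_le_const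
          (f := fun x => ballSup u δ x - u x) (C := M + M) hμK fun x hx => ?_)
        exact (abs_sub _ _).trans
          (add_le_add (abs_ballSup_le hM hδ (hball x hx)) (hM x (hKΩ hx)))
      have h2 : μ.real K ≤ m := ENNReal.toReal_le_of_le_ofReal hm0 hμm
      calc _ ≤ (M + M) * μ.real K := h1
        _ ≤ (M + M) * m := by gcongr
        _ = 2 * m / q * M * q := by field_simp; ring
        _ ≤ (C₁ + 2 * m / q) * M * δ ^ γ := by
          gcongr
          · exact le_add_of_nonneg_left hC₁
          · exact hqδ δ h.le hδR
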